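/- All rings are associative with $1$, not necessarily commutative, and all modules are unital. Let $R$ be a ring that is two-sided coherent, i.e. every finitely generated left ideal of $R$ is a finitely presented left $R$-module and every finitely generated right ideal of $R$ is a finitely presented right $R$-module. Then the following assertions are equivalent: 1. $R$ is a left FGF-ring, i.e. every finitely generated left $R$-module embeds in a free left $R$-module; 2. the module ${}_RR$ is noetherian and is an FP-cogenerator, i.e. for every non-zero homomorphism $f\colon M\to N$ of left $R$-modules with $M$ finitely generated and $N$ finitely presented there is a homomorphism $g\colon N\to {}_RR$ with $gf\neq 0$; 3. the module ${}_RR$ is noetherian and the module $R_R$ is FP-injective, i.e. $\operatorname{Ext}^1_R(F,R_R)=0$ for every finitely presented right $R$-module $F$; 4. $R$ is a left noetherian ring and a left Kasch ring, and the left $R$-module $E({}_RR)$ is flat. Here $E({}_RR)$ denotes the injective hull of ${}_RR$, and $R$ is called left Kasch if $E({}_RR)$ is an injective cogenerator in the category of left $R$-modules, i.e. it is injective and for every non-zero homomorphism $f\colon M\to N$ of left $R$-modules there is a homomorphism $g\colon N\to E({}_RR)$ with $gf\neq0$. -/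

import Mathlib

open scoped TensorProduct

universe u

namespace FGF

/-! Left `R`-modules are `Module R M`; right `R`-modules are `Module Rᵐᵒᵖ M`, with
`MulOpposite.op r • m` playing the role of `m r`. In particular `R_R` is `R` with Mathlib's
instance `Module Rᵐᵒᵖ R`. -/

/-- `R` is left coherent: every finitely generated left ideal is finitely presented. -/
def IsLeftCoherent (R : Type u) [Ring R] : Prop :=
  ∀ I : Submodule R R, I.FG → Module.FinitePresentation R I

/-- `R` is right coherent: every finitely generated right ideal is finitely presented. -/
def IsRightCoherent (R : Type u) [Ring R] : Prop :=
  ∀ I : Submodule Rᵐᵒᵖ R, I.FG → Module.FinitePresentation Rᵐᵒᵖ I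

/-- `R` is a left FGF-ring: every finitely generated left module embeds in a free module. -/
def IsLeftFGF (R : Type u) [Ring R] : Prop :=
  ∀ (M : Type u) [AddCommGroup M] [Module R M], Module.Finite R M →
    ∃ (F : Type u) (_ : AddCommGroup F) (_ : Module R F) (f : M →ₗ[R] F),
      Module.Free R F ∧ Function.Injective f

/-- `K` is an FP-cogenerator: every non-zero homomorphism `f : M → N` with `M` finitely generated
and `N` finitely presented stays non-zero after composition with some `g : N → K`. -/
def IsFPCogenerator (R : Type u) [Ring R] (K : Type u) [AddCommGroup K] [Module R K] : Prop :=
  ∀ (M N : Type u) [AddCommGroup M] [Module R M] [AddCommGroup N] [Module R N],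
    Module.Finite R M → Module.FinitePresentation R N →
      ∀ f : M →ₗ[R] N, f ≠ 0 → ∃ g : N →ₗ[R] K, g ∘ₗ f ≠ 0

/-- `K` is a cogenerator of the category of all modules. -/
def IsCogenerator (R : Type u) [Ring R] (K : Type u) [AddCommGroup K] [Module R K] : Prop :=
  ∀ (M N : Type u) [AddCommGroup M] [Module R M] [AddCommGroup N] [Module R N],
    ∀ f : M →ₗ[R] N, f ≠ 0 → ∃ g : N →ₗ[R] K, g ∘ₗ f ≠ 0

/-- `M` is FP-injective: `Ext¹(F, M) = 0` for every finitely presented `F`. -/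
def IsFPInjective (S : Type u) [Ring S] (M : Type u) [AddCommGroup M] [Module S M] : Prop :=
  ∀ (F : Type u) [AddCommGroup F] [Module S F], Module.FinitePresentation S F →
    Subsingleton (CategoryTheory.Abelian.Ext (ModuleCat.of S F) (ModuleCat.of S M) 1)

/-- The subgroup of `K ⊗[ℤ] M` generated by the elements `k r ⊗ m - k ⊗ r m`. -/
def balancingSubgroup (R : Type u) [Ring R] (K M : Type u) [AddCommGroup K] [Module Rᵐᵒᵖ K]
    [AddCommGroup M] [Module R M] : AddSubgroup (K ⊗[ℤ] M) :=
  AddSubgroup.closure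
    {t | ∃ (k : K) (r : R) (m : M), t = (MulOpposite.op r • k) ⊗ₜ[ℤ] m - k ⊗ₜ[ℤ] (r • m)}

/-- The tensor product `K ⊗_R M` of a right module `K` and a left module `M` over a ring that
need not be commutative. -/
abbrev RTensor (R : Type u) [Ring R] (K M : Type u) [AddCommGroup K] [Module Rᵐᵒᵖ K]
    [AddCommGroup M] [Module R M] : Type u :=
  (K ⊗[ℤ] M) ⧸ balancingSubgroup R K M

theorem balancingSubgroup_le_comap (R : Type u) [Ring R] {K L : Type u} (M : Type u)
    [AddCommGroup K] [Module Rᵐᵒᵖ K] [AddCommGroup L] [Module Rᵐᵒᵖ L]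
    [AddCommGroup M] [Module R M] (f : K →ₗ[Rᵐᵒᵖ] L) :
    balancingSubgroup R K M ≤ (balancingSubgroup R L M).comap
      (LinearMap.rTensor M f.toAddMonoidHom.toIntLinearMap).toAddMonoidHom := by
  refine (AddSubgroup.closure_le _).2 ?_
  rintro _ ⟨k, r, m, rfl⟩
  refine AddSubgroup.subset_closure ⟨f k, r, m, ?_⟩
  simp [map_sub]

/-- The homomorphism `f ⊗ M : K ⊗_R M → L ⊗_R M`. -/
def RTensor.map (R : Type u) [Ring R] {K L : Type u} (M : Type u)
    [AddCommGroup K] [Module Rᵐᵒᵖ K] [AddCommGroup L] [Module Rᵐᵒᵖ L]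
    [AddCommGroup M] [Module R M] (f : K →ₗ[Rᵐᵒᵖ] L) : RTensor R K M →+ RTensor R L M :=
  QuotientAddGroup.map _ _
    (LinearMap.rTensor M f.toAddMonoidHom.toIntLinearMap).toAddMonoidHom
    (balancingSubgroup_le_comap R M f)

/-- The left module `M` is flat: `- ⊗_R M` preserves monomorphisms of right modules. -/
def IsFlat (R : Type u) [Ring R] (M : Type u) [AddCommGroup M] [Module R M] : Prop :=
  ∀ (K L : Type u) [AddCommGroup K] [Module Rᵐᵒᵖ K] [AddCommGroup L] [Module Rᵐᵒᵖ L]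
    (f : K →ₗ[Rᵐᵒᵖ] L), Function.Injective f → Function.Injective (RTensor.map R M f)

/-- `i : M → E` is an injective hull of `M`: `E` is injective, `i` is a monomorphism, and the
image of `i` meets every non-zero submodule of `E` non-trivially. -/
structure IsInjectiveHull (R : Type u) [Ring R] {M E : Type u} [AddCommGroup M] [Module R M]
    [AddCommGroup E] [Module R E] (i : M →ₗ[R] E) : Prop where
  injective_module : Module.Injective R E
  injective : Function.Injective i
  essential : ∀ N : Submodule R E, N ⊓ LinearMap.range i = ⊥ → N = ⊥

theorem exists_maximal_essential (R : Type u) [Ring R] {J : Type u} [AddCommGroup J] [Module R J]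
    (A : Submodule R J) :
    ∃ N, Maximal (fun N : Submodule R J => A ≤ N ∧ ∀ K ≤ N, K ⊓ A = ⊥ → K = ⊥) N := by
  have hchains : ∀ c ⊆ {N : Submodule R J | A ≤ N ∧ ∀ K ≤ N, K ⊓ A = ⊥ → K = ⊥},
      IsChain (· ≤ ·) c → ∀ y ∈ c,
        ∃ ub ∈ {N : Submodule R J | A ≤ N ∧ ∀ K ≤ N, K ⊓ A = ⊥ → K = ⊥}, ∀ z ∈ c, z ≤ ub := by
    intro c hc hchain y hy
    refine ⟨sSup c, ⟨(hc hy).1.trans (le_sSup hy), ?_⟩, fun z hz => le_sSup hz⟩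
    intro K hK hKA
    rw [Submodule.eq_bot_iff]
    intro x hx
    obtain ⟨N, hNc, hxN⟩ := (Submodule.mem_sSup_of_directed ⟨y, hy⟩ hchain.directedOn).1 (hK hx)
    have h1 : R ∙ x ≤ N := (Submodule.span_singleton_le_iff_mem _ _).2 hxN
    have h2 : R ∙ x ≤ K := (Submodule.span_singleton_le_iff_mem _ _).2 hx
    have h3 := (hc hNc).2 _ h1 (eq_bot_iff.2 ((inf_le_inf_right A h2).trans hKA.le))
    exact Submodule.span_singleton_eq_bot.1 h3
  have hA : A ≤ A ∧ ∀ K ≤ A, K ⊓ A = ⊥ → K = ⊥ := by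
    refine ⟨le_rfl, fun K hK h => ?_⟩
    rwa [inf_eq_left.2 hK] at h
  obtain ⟨N, -, hN⟩ := zorn_le_nonempty₀ _ hchains A hA
  exact ⟨N, hN⟩

theorem exists_maximal_disjoint (R : Type u) [Ring R] {J : Type u} [AddCommGroup J] [Module R J]
    (N : Submodule R J) : ∃ C, Maximal (fun C : Submodule R J => C ⊓ N = ⊥) C := by
  have hchains : ∀ c ⊆ {C : Submodule R J | C ⊓ N = ⊥}, IsChain (· ≤ ·) c → ∀ y ∈ c,
      ∃ ub ∈ {C : Submodule R J | C ⊓ N = ⊥}, ∀ z ∈ c, z ≤ ub := by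
    intro c hc hchain y hy
    refine ⟨sSup c, ?_, fun z hz => le_sSup hz⟩
    change sSup c ⊓ N = ⊥
    rw [Submodule.eq_bot_iff]
    rintro x ⟨hx, hxN⟩
    obtain ⟨C, hCc, hxC⟩ := (Submodule.mem_sSup_of_directed ⟨y, hy⟩ hchain.directedOn).1 hx
    have : x ∈ C ⊓ N := ⟨hxC, hxN⟩
    rw [show C ⊓ N = ⊥ from hc hCc] at this
    simpa using this
  obtain ⟨C, -, hC⟩ := zorn_le_nonempty₀ _ hchains ⊥ (bot_inf_eq N)
  exact ⟨C, hC⟩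

theorem exists_isInjectiveHull (R : Type u) [Ring R] (M : Type u) [AddCommGroup M] [Module R M] :
    ∃ (E : ModuleCat.{u} R) (i : M →ₗ[R] E), IsInjectiveHull R i := by
  let J : ModuleCat.{u} R := CategoryTheory.Injective.under (ModuleCat.of R M)
  let j : M →ₗ[R] J := (CategoryTheory.Injective.ι (ModuleCat.of R M)).hom
  have hj : Function.Injective j :=
    (ModuleCat.mono_iff_injective (CategoryTheory.Injective.ι (ModuleCat.of R M))).1 inferInstance
  have hJ : Module.Injective R J :=
    Module.injective_module_of_injective_object R J
      (inj := inferInstanceAs (CategoryTheory.Injective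
        (CategoryTheory.Injective.under (ModuleCat.of R M))))
  obtain ⟨N, ⟨hAN, hess⟩, hmax⟩ := exists_maximal_essential R (LinearMap.range j)
  obtain ⟨C, hCN, hCmax⟩ := exists_maximal_disjoint R N
  have hinj : Function.Injective (C.mkQ ∘ₗ N.subtype) := by
    rw [← LinearMap.ker_eq_bot, Submodule.eq_bot_iff]
    intro x hx
    have hxC : (x : J) ∈ C := by simpa using hx
    have : (x : J) ∈ C ⊓ N := ⟨hxC, x.2⟩
    rw [hCN] at this
    simpa using this
  obtain ⟨g, hg⟩ := hJ.out _ hinj N.subtype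
  let p : J →ₗ[R] J := g ∘ₗ C.mkQ
  have hpN : ∀ x ∈ N, p x = x := fun x hx => hg ⟨x, hx⟩
  have hpC : ∀ x ∈ C, p x = 0 := fun x hx => by
    have : C.mkQ x = 0 := by simpa using hx
    simp only [p, LinearMap.comp_apply, this, map_zero]
  have hNp : N ≤ LinearMap.range p := fun x hx => ⟨x, hpN x hx⟩
  have hrange : LinearMap.range p ≤ N := by
    refine hmax ⟨hAN.trans hNp, fun K hK hKA => ?_⟩ hNp
    have hKN : K ⊓ N = ⊥ := hess _ inf_le_right
      (eq_bot_iff.2 ((inf_le_inf_right _ inf_le_left).trans hKA.le))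
    have hL : K.comap p ⊓ N = ⊥ := by
      rw [Submodule.eq_bot_iff]
      rintro x ⟨hx, hxN⟩
      have hxK : p x ∈ K := hx
      rw [hpN x hxN] at hxK
      have : x ∈ K ⊓ N := ⟨hxK, hxN⟩
      rw [hKN] at this
      simpa using this
    have hCL : C ≤ K.comap p := fun x hx => by
      rw [Submodule.mem_comap, hpC x hx]
      exact K.zero_mem
    have hLC := hCmax hL hCL
    rw [Submodule.eq_bot_iff]
    intro x hx
    obtain ⟨y, rfl⟩ := hK hx
    exact hpC y (hLC hx)
  let q : J →ₗ[R] N := p.codRestrict N fun x => hrange ⟨x, rfl⟩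
  refine ⟨ModuleCat.of R N, j.codRestrict N fun x => hAN ⟨x, rfl⟩, ⟨?_⟩, ?_, ?_⟩
  · intro X Y _ _ _ _ f hf h
    obtain ⟨k, hk⟩ := hJ.out f hf (N.subtype ∘ₗ h)
    refine ⟨q ∘ₗ k, fun x => Subtype.ext ?_⟩
    change p (k (f x)) = h x
    rw [hk]
    exact hpN _ (h x).2
  · intro x y hxy
    exact hj (congrArg Subtype.val hxy)
  · intro (K : Submodule R N) hK
    have h1 : K.map N.subtype = ⊥ := by
      refine hess _ (Submodule.map_subtype_le N K) ?_
      rw [Submodule.eq_bot_iff]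
      rintro _ ⟨⟨y, hy, rfl⟩, ⟨m, hm⟩⟩
      have : y ∈ K ⊓ LinearMap.range (j.codRestrict N fun x => hAN ⟨x, rfl⟩) :=
        ⟨hy, ⟨m, Subtype.ext hm⟩⟩
      have h0 : y ∈ (⊥ : Submodule R N) := hK ▸ this
      rw [(Submodule.mem_bot R).1 h0, map_zero]
    exact Submodule.map_injective_of_injective N.injective_subtype
      (h1.trans (Submodule.map_bot _).symm)

/-- The injective hull `E(M)` of `M` (unique up to isomorphism over `M`). -/
noncomputable def injectiveHull (R : Type u) [Ring R] (M : Type u) [AddCommGroup M] [Module R M] :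
    ModuleCat.{u} R :=
  (exists_isInjectiveHull R M).choose

/-- The inclusion `M → E(M)`. -/
noncomputable def toInjectiveHull (R : Type u) [Ring R] (M : Type u) [AddCommGroup M]
    [Module R M] : M →ₗ[R] injectiveHull R M :=
  (exists_isInjectiveHull R M).choose_spec.choose

theorem isInjectiveHull_toInjectiveHull (R : Type u) [Ring R] (M : Type u) [AddCommGroup M]
    [Module R M] : IsInjectiveHull R (toInjectiveHull R M) :=
  (exists_isInjectiveHull R M).choose_spec.choose_spec

/-- `R` is a left Kasch ring: the injective hull `E(_R R)` is an (injective) cogenerator of the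
category of left modules. -/
def IsLeftKasch (R : Type u) [Ring R] : Prop :=
  Module.Injective R (injectiveHull R R) ∧ IsCogenerator R (injectiveHull R R)

end FGF

namespace FGF

/-! ### Vanishing of Ext¹ as an extension problem. -/

section ExtOne

open CategoryTheory Abelian

/-! Each assertion amounts to: `R` is left noetherian and homomorphisms to `R` separate the points
of every finitely generated left module (`SeparatesFG`). FGF gives separation by coordinates, and
noetherianity by left coherence applied to an embedding of `R ⧸ I` in some `R ^ k`.

For the rest, present `N` as `R ^ m` modulo the rows of an `n × m` matrix `A`. Then Hom(N, R) is the
kernel of the right-linear map `T : R ^ m → R ^ n` given by `A`. Right coherence makes this kernel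
finitely generated, and under separation finitely many generators together embed `N` in `R ^ k`,
which is FGF.

A row `c` whose class in `N` is killed by all homomorphisms to `R` is one that factors as `φ ∘ T`
with `φ : im T → R`. If `R_R` is FP-injective, `φ` extends to `R ^ n`, so `c` is a combination of
rows and its class is zero; read backwards, separation gives FP-injectivity. If instead `E(R)` is
flat, tensoring `im T → R ^ n` with it shows that every map `N → E(R)` kills the class of `c`, so
the cogenerator property makes it zero. Conversely, embeddings in `R ^ k` make inclusions of
finitely generated submodules of `E(R)` factor through free modules, whence flatness. -/

theorem subsingleton_ext_one_iff {S : Type u} [Ring S] {P F : Type u} (M : Type u)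
    [AddCommGroup P] [Module S P] [AddCommGroup F] [Module S F] [AddCommGroup M] [Module S M]
    [Module.Projective S P] (f : P →ₗ[S] F) (hf : Function.Surjective f) :
    Subsingleton (Ext (ModuleCat.of S F) (ModuleCat.of S M) 1) ↔
      ∀ φ : LinearMap.ker f →ₗ[S] M, ∃ Φ : P →ₗ[S] M, Φ ∘ₗ (LinearMap.ker f).subtype = φ := by
  have hS := LinearMap.shortExact_shortComplexKer hf
  have : Projective f.shortComplexKer.X₂ :=
    ModuleCat.projective_of_categoryTheory_projective (ModuleCat.of S P)
  constructor
  · intro hsub φ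
    -- The obstruction to extending `φ` is its product with the extension class, which lies in the
    -- vanishing Ext¹.
    obtain ⟨x, hx⟩ := Ext.contravariant_sequence_exact₁ hS (ModuleCat.of S M)
      (Ext.mk₀ (ModuleCat.ofHom φ)) (add_zero 1)
      ((hsub : Subsingleton (Ext f.shortComplexKer.X₃ (ModuleCat.of S M) 1)).elim _ _)
    obtain ⟨Φ, rfl⟩ := (Ext.mk₀_bijective _ _).2 x
    rw [Ext.mk₀_comp_mk₀] at hx
    have h := (Ext.mk₀_bijective _ _).1 hx
    exact ⟨Φ.hom, congrArg ModuleCat.Hom.hom h⟩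
  · intro h
    refine subsingleton_of_forall_eq 0 fun e => ?_
    -- Since Ext¹(P, M) = 0, every class comes from some `φ` on the kernel.
    obtain ⟨x, rfl⟩ := Ext.contravariant_sequence_exact₃ hS (ModuleCat.of S M) e
      (Ext.eq_zero_of_projective _) (add_zero 1)
    obtain ⟨φ, rfl⟩ := (Ext.mk₀_bijective _ _).2 x
    obtain ⟨Φ, hΦ⟩ := h φ.hom
    have hφ : φ = f.shortComplexKer.f ≫ ModuleCat.ofHom Φ := by
      ext1
      exact hΦ.symm
    rw [hφ, ← Ext.mk₀_comp_mk₀]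
    exact hS.extClass_comp_assoc _

end ExtOne

theorem isFPInjective_iff {S M : Type u} [Ring S] [AddCommGroup M] [Module S M] :
    IsFPInjective S M ↔ ∀ (n : ℕ) (K : Submodule S (Fin n → S)), K.FG →
      ∀ φ : K →ₗ[S] M, ∃ Φ : (Fin n → S) →ₗ[S] M, Φ ∘ₗ K.subtype = φ := by
  constructor
  · intro h n K hK
    have hF : Module.FinitePresentation S ((Fin n → S) ⧸ K) :=
      Module.finitePresentation_of_surjective K.mkQ K.mkQ_surjective (by rwa [K.ker_mkQ])
    have := (subsingleton_ext_one_iff M K.mkQ K.mkQ_surjective).1 (h _ hF)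
    rwa [K.ker_mkQ] at this
  · intro h F _ _ hF
    obtain ⟨n, m, f, g, hf, hg⟩ := hF.exists_fin'
    exact (subsingleton_ext_one_iff M f hf).2
      (h n _ (Module.FinitePresentation.fg_ker f hf))

/-! ### Coherence and submodules of free modules. -/

/-- Over a coherent ring, finitely generated submodules of `S ^ n` are finitely presented. -/
theorem finitePresentation_of_fg_submodule_pi {S : Type u} [Ring S]
    (hS : ∀ I : Submodule S S, I.FG → Module.FinitePresentation S I) :
    ∀ (n : ℕ) (K : Submodule S (Fin n → S)), K.FG → Module.FinitePresentation S K
  | 0, K, _ => inferInstance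
  | n + 1, K, hK => by
    have hfin : Module.Finite S K := Module.Finite.iff_fg.2 hK
    let p : K →ₗ[S] S := LinearMap.proj 0 ∘ₗ K.subtype
    have : Module.FinitePresentation S (LinearMap.range p) :=
      hS _ (Module.Finite.iff_fg.1 inferInstance)
    have hker := Module.FinitePresentation.fg_ker p.rangeRestrict p.surjective_rangeRestrict
    -- Elements of the kernel have zeroth coordinate 0, so dropping it embeds the kernel in `S ^ n`
    -- and the induction applies.
    let t : LinearMap.ker p.rangeRestrict →ₗ[S] (Fin n → S) :=
      LinearMap.funLeft S S Fin.succ ∘ₗ K.subtype ∘ₗ Submodule.subtype _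
    have ht : Function.Injective t := by
      intro x y hxy
      refine Subtype.ext (Subtype.ext (funext fun i => ?_))
      refine Fin.cases ?_ (fun j => congrFun hxy j) i
      exact congrArg Subtype.val
        ((LinearMap.mem_ker.1 x.2).trans (LinearMap.mem_ker.1 y.2).symm)
    have : Module.Finite S (LinearMap.ker p.rangeRestrict) := Module.Finite.iff_fg.2 hker
    have := finitePresentation_of_fg_submodule_pi hS n (LinearMap.range t)
      (Module.Finite.iff_fg.1 inferInstance)
    have := Module.FinitePresentation.of_equiv (M := LinearMap.range t)
      (N := LinearMap.ker p.rangeRestrict) (LinearEquiv.ofInjective t ht).symm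
    exact Module.finitePresentation_of_ker p.rangeRestrict p.surjective_rangeRestrict

/-! ### Separation of points and FGF-rings. -/

/-- Homomorphisms to `R` separate the elements of finitely generated left modules. -/
def SeparatesFG (R : Type u) [Ring R] : Prop :=
  ∀ (N : Type u) [AddCommGroup N] [Module R N], Module.Finite R N →
    ∀ x : N, x ≠ 0 → ∃ g : N →ₗ[R] R, g x ≠ 0

variable {R : Type u} [Ring R]

theorem IsLeftFGF.separatesFG (h : IsLeftFGF R) : SeparatesFG R := by
  intro N _ _ hN x hx
  obtain ⟨F, _, _, f, hF, hf⟩ := h N hN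
  have h0 : f x ≠ 0 := fun h => hx (hf (h.trans f.map_zero.symm))
  by_contra! hg
  refine h0 ((Module.Free.chooseBasis R F).repr.map_eq_zero_iff.1 (Finsupp.ext fun i => ?_))
  exact hg ((Module.Free.chooseBasis R F).coord i ∘ₗ f)

/-- Only finitely many basis vectors occur in the images of a finite generating set, and their
coordinates suffice. -/
theorem exists_injective_pi_of_injective_free {M F : Type*} [AddCommGroup M] [Module R M]
    [AddCommGroup F] [Module R F] [Module.Finite R M] [Module.Free R F] (f : M →ₗ[R] F)
    (hf : Function.Injective f) : ∃ (k : ℕ) (g : M →ₗ[R] (Fin k → R)), Function.Injective g := by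
  let b := Module.Free.chooseBasis R F
  obtain ⟨s, hs⟩ := Module.Finite.fg_top (R := R) (M := M)
  classical
  let T := s.biUnion fun x => (b.repr (f x)).support
  let g : M →ₗ[R] (T → R) := LinearMap.pi fun i => b.coord i.1 ∘ₗ f
  have hg : Function.Injective g := by
    have hsupp : ∀ x, b.repr (f x) ∈ Finsupp.supported R R (T : Set _) := by
      intro x
      have : (⊤ : Submodule R M) ≤
          (Finsupp.supported R R (T : Set _)).comap (b.repr.toLinearMap ∘ₗ f) := by
        rw [← hs, Submodule.span_le]
        intro y hy
        refine (Finsupp.mem_supported R _).2 fun i hi => ?_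
        exact Finset.mem_biUnion.2 ⟨y, hy, hi⟩
      exact this trivial
    rw [injective_iff_map_eq_zero]
    intro x hx
    refine hf ((b.repr.map_eq_zero_iff.1 (Finsupp.ext fun i => ?_)).trans f.map_zero.symm)
    by_cases hi : i ∈ T
    · exact congrFun hx ⟨i, hi⟩
    · exact (Finsupp.mem_supported' R _).1 (hsupp x) i hi
  exact ⟨_, (LinearEquiv.funCongrLeft R R T.equivFin.symm).toLinearMap ∘ₗ g,
    (LinearEquiv.funCongrLeft R R T.equivFin.symm).injective.comp hg⟩

/-- Embedded in some `R ^ k`, the module `R ⧸ I` is finitely presented by coherence, so the kernel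
`I` of `R → R ⧸ I` is finitely generated. -/
theorem IsLeftFGF.isNoetherian (hl : IsLeftCoherent R) (h : IsLeftFGF R) : IsNoetherian R R := by
  refine ⟨fun I => ?_⟩
  obtain ⟨F, _, _, f, hF, hf⟩ := h (R ⧸ I) inferInstance
  obtain ⟨k, g, hg⟩ := exists_injective_pi_of_injective_free f hf
  have := finitePresentation_of_fg_submodule_pi hl k (LinearMap.range g)
    (Module.Finite.iff_fg.1 inferInstance)
  have := Module.FinitePresentation.of_equiv (LinearEquiv.ofInjective g hg).symm
  simpa using Module.FinitePresentation.fg_ker I.mkQ I.mkQ_surjective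

/-! ### Matrix presentations and the dual module. -/

open MulOpposite

/-- The right module `R_R` is the regular left module over `Rᵐᵒᵖ`. -/
def opLinearEquivSelf (R : Type u) [Ring R] : R ≃ₗ[Rᵐᵒᵖ] Rᵐᵒᵖ where
  __ := opAddEquiv
  map_smul' _ _ := rfl

theorem IsRightCoherent.finitePresentation (hr : IsRightCoherent R) (I : Submodule Rᵐᵒᵖ Rᵐᵒᵖ)
    (hI : I.FG) : Module.FinitePresentation Rᵐᵒᵖ I := by
  let e := (opLinearEquivSelf R).symm
  have := hr (I.map e.toLinearMap) (hI.map _)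
  exact Module.FinitePresentation.of_equiv (e.submoduleMap I).symm

/-- The columns of a matrix over `R`, as elements of the free right module of rank `n`. -/
def columns {n m : ℕ} (A : Fin n → Fin m → R) : Fin m → (Fin n → Rᵐᵒᵖ) := fun j i => op (A i j)

theorem linearCombination_op_apply {m : ℕ} (c : Fin m → R) (b : Fin m → Rᵐᵒᵖ) :
    Fintype.linearCombination Rᵐᵒᵖ c b = ∑ j, c j * (b j).unop := by
  simp [Fintype.linearCombination_apply]

theorem linearCombination_columns_apply {n m : ℕ} (A : Fin n → Fin m → R) (b : Fin m → Rᵐᵒᵖ)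
    (i : Fin n) : Fintype.linearCombination Rᵐᵒᵖ (columns A) b i =
      op (∑ j, A i j * (b j).unop) := by
  simp [Fintype.linearCombination_apply, columns]

/-- A finitely generated module over a left noetherian ring is given by a finite matrix. -/
theorem exists_matrix_presentation [IsNoetherian R R] (N : Type*) [AddCommGroup N] [Module R N]
    [Module.Finite R N] : ∃ (n m : ℕ) (A : Fin n → Fin m → R) (p : (Fin m → R) →ₗ[R] N),
      Function.Surjective p ∧ LinearMap.ker p = Submodule.span R (Set.range A) := by
  obtain ⟨m, p, hp⟩ := Module.Finite.exists_fin' R N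
  obtain ⟨n, A, hA⟩ := Submodule.fg_iff_exists_fin_generating_family.1
    (IsNoetherian.noetherian (LinearMap.ker p))
  exact ⟨n, m, A, p, hp, hA.symm⟩

/-- A column annihilated by the rows of `A` defines a homomorphism on the module presented
by `A`. -/
theorem exists_hom_of_mem_ker {N : Type*} [AddCommGroup N] [Module R N] {n m : ℕ}
    {A : Fin n → Fin m → R} {p : (Fin m → R) →ₗ[R] N} (hp : Function.Surjective p)
    (hA : LinearMap.ker p = Submodule.span R (Set.range A)) (b : Fin m → Rᵐᵒᵖ)
    (hb : Fintype.linearCombination Rᵐᵒᵖ (columns A) b = 0) :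
    ∃ g : N →ₗ[R] R, ∀ c, g (p c) = ∑ j, c j * (b j).unop := by
  let ψ : (Fin m → R) →ₗ[R] R := Fintype.linearCombination R fun j => (b j).unop
  have hψ : LinearMap.ker p ≤ LinearMap.ker ψ := by
    rw [hA, Submodule.span_le]
    rintro _ ⟨i, rfl⟩
    have := congrFun hb i
    rw [linearCombination_columns_apply] at this
    exact op_injective this
  refine ⟨(LinearMap.ker p).liftQ ψ hψ ∘ₗ (p.quotKerEquivOfSurjective hp).symm.toLinearMap,
    fun c => ?_⟩
  have : (p.quotKerEquivOfSurjective hp).symm (p c) = (LinearMap.ker p).mkQ c := by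
    rw [LinearEquiv.symm_apply_eq]
    rfl
  simp [this, ψ, Fintype.linearCombination_apply]

/-- A homomorphism is determined by its values on the images of the standard basis. -/
theorem hom_apply_eq_sum {N : Type*} [AddCommGroup N] [Module R N] {m : ℕ}
    {p : (Fin m → R) →ₗ[R] N} (E : Type*) [AddCommGroup E] [Module R E] (g : N →ₗ[R] E)
    (c : Fin m → R) : g (p c) = ∑ j, c j • g (p (Pi.single j 1)) := by
  conv_lhs => rw [← LinearMap.comp_apply, pi_eq_sum_univ' c]
  simp only [map_sum, map_smul, LinearMap.comp_apply]

/-- Converse to `exists_hom_of_mem_ker`: the two identify Hom(N, R) with the kernel of the matrix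
acting on columns. -/
theorem linearCombination_columns_hom {N : Type*} [AddCommGroup N] [Module R N] {n m : ℕ}
    {A : Fin n → Fin m → R} {p : (Fin m → R) →ₗ[R] N}
    (hA : LinearMap.ker p = Submodule.span R (Set.range A)) (g : N →ₗ[R] R) :
    Fintype.linearCombination Rᵐᵒᵖ (columns A) (fun j => op (g (p (Pi.single j 1)))) = 0 := by
  funext i
  rw [linearCombination_columns_apply]
  have h : p (A i) = 0 := by
    rw [← LinearMap.mem_ker, hA]
    exact Submodule.subset_span ⟨i, rfl⟩
  have := hom_apply_eq_sum (p := p) R g (A i)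
  rw [h, map_zero] at this
  exact congrArg op this.symm

/-- Right coherence makes Hom(N, R) finitely generated; an element killed by its generators is
killed by all of it, hence zero by separation. -/
theorem SeparatesFG.exists_injective_pi [IsNoetherian R R] (hr : IsRightCoherent R)
    (h : SeparatesFG R) (N : Type u) [AddCommGroup N] [Module R N] [Module.Finite R N] :
    ∃ (k : ℕ) (g : N →ₗ[R] (Fin k → R)), Function.Injective g := by
  obtain ⟨n, m, A, p, hp, hA⟩ := exists_matrix_presentation (R := R) N
  let T := Fintype.linearCombination Rᵐᵒᵖ (columns A)
  have := finitePresentation_of_fg_submodule_pi hr.finitePresentation n (LinearMap.range T)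
    (Module.Finite.iff_fg.1 inferInstance)
  have hker := Module.FinitePresentation.fg_ker T.rangeRestrict T.surjective_rangeRestrict
  rw [LinearMap.ker_rangeRestrict] at hker
  obtain ⟨k, b, hb⟩ := Submodule.fg_iff_exists_fin_generating_family.1 hker
  choose g hg using fun l => exists_hom_of_mem_ker hp hA (b l)
    (LinearMap.mem_ker.1 (hb ▸ Submodule.subset_span ⟨l, rfl⟩ : b l ∈ LinearMap.ker T))
  refine ⟨k, LinearMap.pi g, ?_⟩
  rw [injective_iff_map_eq_zero]
  intro x hx
  obtain ⟨c, rfl⟩ := hp x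
  by_contra hx0
  obtain ⟨q, hq⟩ := h N inferInstance _ hx0
  have hle : LinearMap.ker T ≤ LinearMap.ker (Fintype.linearCombination Rᵐᵒᵖ c) := by
    rw [← hb, Submodule.span_le]
    rintro _ ⟨l, rfl⟩
    change Fintype.linearCombination Rᵐᵒᵖ c (b l) = 0
    rw [linearCombination_op_apply, ← hg]
    exact congrFun hx l
  have h0 := hle (LinearMap.mem_ker.2 (linearCombination_columns_hom hA q))
  rw [LinearMap.mem_ker, linearCombination_op_apply] at h0
  refine hq ?_
  rw [hom_apply_eq_sum]
  simpa using h0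

theorem SeparatesFG.isLeftFGF [IsNoetherian R R] (hr : IsRightCoherent R) (h : SeparatesFG R) :
    IsLeftFGF R := by
  intro M _ _ hM
  obtain ⟨k, g, hg⟩ := h.exists_injective_pi hr M
  exact ⟨Fin k → R, inferInstance, inferInstance, g, inferInstance, hg⟩

/-! ### FP-cogenerators, FP-injectivity and the Kasch property. -/

theorem isFPCogenerator_iff_separatesFG [IsNoetherian R R] :
    IsFPCogenerator R R ↔ SeparatesFG R := by
  constructor
  · intro h N _ _ hN x hx
    have : Module.FinitePresentation R N := Module.finitePresentation_of_finite R N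
    obtain ⟨g, hg⟩ := h R N inferInstance inferInstance (LinearMap.toSpanSingleton R N x)
      (fun h => hx (by simpa using LinearMap.congr_fun h 1))
    exact ⟨g, fun h0 => hg (LinearMap.ext_ring (by simpa using h0))⟩
  · intro h M N _ _ _ _ _ hN f hf
    obtain ⟨x, hx⟩ : ∃ x, f x ≠ 0 := by
      by_contra! h0
      exact hf (LinearMap.ext h0)
    obtain ⟨g, hg⟩ := h N inferInstance _ hx
    exact ⟨g, fun h0 => hg (LinearMap.congr_fun h0 x)⟩

/-- If every homomorphism to `R` vanishes at the class of the row `c`, then the columns of `A` map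
to the entries of `c` under some homomorphism of right modules. -/
theorem exists_hom_columns {N : Type*} [AddCommGroup N] [Module R N] {n m : ℕ}
    {A : Fin n → Fin m → R} {p : (Fin m → R) →ₗ[R] N} (hp : Function.Surjective p)
    (hA : LinearMap.ker p = Submodule.span R (Set.range A)) (c : Fin m → R)
    (hc : ∀ g : N →ₗ[R] R, g (p c) = 0) :
    ∃ φ : LinearMap.range (Fintype.linearCombination Rᵐᵒᵖ (columns A)) →ₗ[Rᵐᵒᵖ] R,
      ∀ b, φ (LinearMap.rangeRestrict _ b) = Fintype.linearCombination Rᵐᵒᵖ c b := by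
  let T := Fintype.linearCombination Rᵐᵒᵖ (columns A)
  have hle : LinearMap.ker T ≤ LinearMap.ker (Fintype.linearCombination Rᵐᵒᵖ c) := by
    intro b hb
    obtain ⟨g, hg⟩ := exists_hom_of_mem_ker hp hA b hb
    rw [LinearMap.mem_ker, linearCombination_op_apply, ← hg, hc]
  refine ⟨(LinearMap.ker T).liftQ _ hle ∘ₗ T.quotKerEquivRange.symm.toLinearMap, fun b => ?_⟩
  have : T.quotKerEquivRange.symm (T.rangeRestrict b) = (LinearMap.ker T).mkQ b := by
    rw [LinearEquiv.symm_apply_eq]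
    rfl
  simp [T, this]

theorem columns_eq_sum {n m : ℕ} (A : Fin n → Fin m → R) (j : Fin m) :
    columns A j = ∑ i, op (A i j) • (Pi.single i 1 : Fin n → Rᵐᵒᵖ) := by
  ext i
  simp [columns, Pi.single_apply]

/-- An extension `Φ` of `φ` to the free module is left multiplication by a row, which exhibits `c`
as a combination of the rows of `A`. -/
theorem IsFPInjective.separatesFG [IsNoetherian R R] (h : IsFPInjective Rᵐᵒᵖ R) :
    SeparatesFG R := by
  intro N _ _ hN x hx
  by_contra! hc
  obtain ⟨n, m, A, p, hp, hA⟩ := exists_matrix_presentation (R := R) N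
  obtain ⟨c, rfl⟩ := hp x
  obtain ⟨φ, hφ⟩ := exists_hom_columns hp hA c hc
  obtain ⟨Φ, hΦ⟩ := isFPInjective_iff.1 h n _ (Module.Finite.iff_fg.1 inferInstance) φ
  refine hx ?_
  rw [← LinearMap.mem_ker, hA]
  have hcA : c = ∑ i, Φ (Pi.single i 1) • A i := by
    ext j
    have h1 := hφ (Pi.single j 1)
    rw [← hΦ] at h1
    rw [LinearMap.comp_apply, Fintype.linearCombination_apply_single, one_smul] at h1
    change Φ (Fintype.linearCombination Rᵐᵒᵖ (columns A) (Pi.single j 1)) = c j at h1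
    rw [Fintype.linearCombination_apply_single, one_smul, columns_eq_sum] at h1
    rw [← h1]
    simp
  rw [hcA]
  exact Submodule.sum_mem _ fun i _ => Submodule.smul_mem _ _ (Submodule.subset_span ⟨i, rfl⟩)

/-- Use the generators of `K` as columns of a matrix: extending `φ` means writing the row `c` of its
values as a combination of the rows. -/
theorem SeparatesFG.isFPInjective (h : SeparatesFG R) : IsFPInjective Rᵐᵒᵖ R := by
  refine isFPInjective_iff.2 fun n K hK φ => ?_
  obtain ⟨m, a, rfl⟩ := Submodule.fg_iff_exists_fin_generating_family.1 hK
  let a' : Fin m → Submodule.span Rᵐᵒᵖ (Set.range a) :=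
    fun j => ⟨a j, Submodule.subset_span ⟨j, rfl⟩⟩
  let A : Fin n → Fin m → R := fun i j => (a j i).unop
  let c : Fin m → R := fun j => φ (a' j)
  let L := Submodule.span R (Set.range A)
  have hcL : c ∈ L := by
    by_contra hc
    obtain ⟨g, hg⟩ := h ((Fin m → R) ⧸ L) inferInstance (L.mkQ c)
      (fun h0 => hc (by simpa using h0))
    -- A functional on `R ^ m` modulo the rows is a linear relation among the columns; `φ` respects
    -- it, so the functional kills `c`.
    let b : Fin m → Rᵐᵒᵖ := fun j => op (g (L.mkQ (Pi.single j 1)))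
    have hb : ∑ j, b j • a' j = 0 := by
      have := linearCombination_columns_hom (A := A) (p := L.mkQ) L.ker_mkQ g
      rw [Fintype.linearCombination_apply] at this
      refine Subtype.ext ?_
      rw [AddSubmonoidClass.coe_finsetSum]
      exact this
    have := congrArg φ hb
    rw [map_sum, map_zero] at this
    refine hg ?_
    rw [hom_apply_eq_sum]
    simpa [b, c] using this
  obtain ⟨r, hr⟩ := (Submodule.mem_span_range_iff_exists_fun R).1 hcL
  refine ⟨Fintype.linearCombination Rᵐᵒᵖ r, ?_⟩
  have hgen : ∀ x (hx : x ∈ Submodule.span Rᵐᵒᵖ (Set.range a)),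
      Fintype.linearCombination Rᵐᵒᵖ r x = φ ⟨x, hx⟩ := by
    intro x hx
    induction hx using Submodule.span_induction with
    | mem x hx =>
      obtain ⟨j, rfl⟩ := hx
      rw [linearCombination_op_apply]
      have := congrFun hr j
      simpa [A, c] using this
    | zero => exact (map_zero _).trans (map_zero φ).symm
    | add x y hx hy h1 h2 =>
      rw [map_add, h1, h2, ← map_add]
      rfl
    | smul s x hx h1 =>
      rw [map_smul, h1, ← map_smul]
      rfl
  ext x
  exact hgen x.1 x.2

/-- Separate a non-zero value of `f` inside the cyclic module it generates, then extend to all of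
`N` by injectivity of the hull. -/
theorem SeparatesFG.isLeftKasch (h : SeparatesFG R) : IsLeftKasch R := by
  have hE := isInjectiveHull_toInjectiveHull R R
  refine ⟨hE.injective_module, fun M N _ _ _ _ f hf => ?_⟩
  obtain ⟨m, hm⟩ : ∃ x, f x ≠ 0 := by
    by_contra! h0
    exact hf (LinearMap.ext h0)
  let X := Submodule.span R {f m}
  let x : X := ⟨f m, Submodule.mem_span_singleton_self _⟩
  obtain ⟨g, hg⟩ := h X inferInstance x (fun h0 => hm (congrArg Subtype.val h0))
  obtain ⟨k, hk⟩ := hE.injective_module.out X.subtype X.injective_subtype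
    (toInjectiveHull R R ∘ₗ g)
  refine ⟨k, fun h0 => hg (hE.injective ?_)⟩
  rw [map_zero]
  exact (hk x).symm.trans (LinearMap.congr_fun h0 m)

/-! ### Tensor products over a noncommutative ring. -/

namespace RTensor

section

variable {K L M N : Type u} [AddCommGroup K] [Module Rᵐᵒᵖ K] [AddCommGroup L] [Module Rᵐᵒᵖ L]
  [AddCommGroup M] [Module R M] [AddCommGroup N] [Module R N]

variable (R) in
/-- The class of a pure tensor. -/
def tmul (k : K) (m : M) : RTensor R K M := QuotientAddGroup.mk (k ⊗ₜ[ℤ] m)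

theorem tmul_add (k : K) (m m' : M) : tmul R k (m + m') = tmul R k m + tmul R k m' :=
  congrArg QuotientAddGroup.mk (TensorProduct.tmul_add k m m')

theorem add_tmul (k k' : K) (m : M) : tmul R (k + k') m = tmul R k m + tmul R k' m :=
  congrArg QuotientAddGroup.mk (TensorProduct.add_tmul k k' m)

theorem smul_tmul (k : K) (r : R) (m : M) : tmul R (op r • k) m = tmul R k (r • m) := by
  refine (QuotientAddGroup.eq_iff_sub_mem).2 ?_
  exact AddSubgroup.subset_closure ⟨k, r, m, rfl⟩

/-- Tensoring with a fixed right factor, as an additive homomorphism. -/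
def tmulLeft (m : M) : K →+ RTensor R K M :=
  AddMonoidHom.mk' (fun k => tmul R k m) fun k k' => add_tmul k k' m

/-- Tensoring with a fixed left factor, as an additive homomorphism. -/
def tmulRight (k : K) : M →+ RTensor R K M :=
  AddMonoidHom.mk' (fun m => tmul R k m) fun m m' => tmul_add k m m'

theorem sum_tmul {ι : Type*} (s : Finset ι) (k : ι → K) (m : M) :
    tmul R (∑ i ∈ s, k i) m = ∑ i ∈ s, tmul R (k i) m := map_sum (tmulLeft m) k s

theorem tmul_sum {ι : Type*} (s : Finset ι) (k : K) (m : ι → M) :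
    tmul R k (∑ i ∈ s, m i) = ∑ i ∈ s, tmul R k (m i) := map_sum (tmulRight k) m s

@[elab_as_elim]
theorem induction {P : RTensor R K M → Prop} (t : RTensor R K M)
    (tmul : ∀ k m, P (tmul R k m)) (add : ∀ s t, P s → P t → P (s + t)) : P t := by
  obtain ⟨t, rfl⟩ := QuotientAddGroup.mk_surjective t
  induction t with
  | zero => simpa [RTensor.tmul] using tmul 0 0
  | tmul k m => exact tmul k m
  | add s t hs ht => exact add _ _ hs ht

/-- A balanced biadditive map induces a homomorphism on the tensor product. -/
def lift {P : Type*} [AddCommGroup P] (B : K →+ M →+ P)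
    (hB : ∀ k (r : R) m, B (op r • k) m = B k (r • m)) : RTensor R K M →+ P :=
  QuotientAddGroup.lift _
    (TensorProduct.liftAddHom B fun n k m => by simp) <| by
    refine (AddSubgroup.closure_le _).2 ?_
    rintro _ ⟨k, r, m, rfl⟩
    simp [hB]

@[simp]
theorem map_tmul (f : K →ₗ[Rᵐᵒᵖ] L) (k : K) (m : M) :
    RTensor.map R M f (tmul R k m) = tmul R (f k) m := rfl

variable (K) in
theorem balancingSubgroup_le_comap_lTensor (g : M →ₗ[R] N) :
    balancingSubgroup R K M ≤ (balancingSubgroup R K N).comap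
      (LinearMap.lTensor K g.toAddMonoidHom.toIntLinearMap).toAddMonoidHom := by
  refine (AddSubgroup.closure_le _).2 ?_
  rintro _ ⟨k, r, m, rfl⟩
  refine AddSubgroup.subset_closure ⟨k, r, g m, ?_⟩
  simp [map_sub]

variable (K) in
/-- The homomorphism `K ⊗ g : K ⊗_R M → K ⊗_R N`. -/
def mapRight (g : M →ₗ[R] N) : RTensor R K M →+ RTensor R K N :=
  QuotientAddGroup.map _ _
    (LinearMap.lTensor K g.toAddMonoidHom.toIntLinearMap).toAddMonoidHom
    (balancingSubgroup_le_comap_lTensor K g)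

theorem map_mapRight (f : K →ₗ[Rᵐᵒᵖ] L) (g : M →ₗ[R] N) (t : RTensor R K M) :
    RTensor.map R N f (mapRight K g t) = mapRight L g (RTensor.map R M f t) := by
  induction t using RTensor.induction with
  | tmul k m => rfl
  | add s t hs ht => simp only [map_add, hs, ht]

theorem mapRight_comp {P : Type u} [AddCommGroup P] [Module R P] (h : N →ₗ[R] P) (g : M →ₗ[R] N)
    (t : RTensor R K M) : mapRight K (h ∘ₗ g) t = mapRight K h (mapRight K g t) := by
  induction t using RTensor.induction with
  | tmul k m => rfl
  | add s t hs ht => simp only [map_add, hs, ht]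

variable (R K) in
/-- The coordinates of an element of `K ⊗_R R ^ n`. -/
def coords (n : ℕ) (i : Fin n) : RTensor R K (Fin n → R) →+ K :=
  lift (AddMonoidHom.mk' (fun k => AddMonoidHom.mk' (fun v : Fin n → R => op (v i) • k)
    fun v w => by simp [add_smul]) fun k k' => by ext; simp) fun k r v => by simp [mul_smul]

@[simp]
theorem coords_tmul (n : ℕ) (i : Fin n) (k : K) (v : Fin n → R) :
    coords R K n i (tmul R k v) = op (v i) • k := rfl

theorem eq_sum_coords (n : ℕ) (t : RTensor R K (Fin n → R)) :
    t = ∑ i, tmul R (coords R K n i t) (Pi.single i 1) := by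
  induction t using RTensor.induction with
  | tmul k v =>
    simp only [coords_tmul, smul_tmul]
    rw [← tmul_sum]
    congr 1
    ext i
    simp [Pi.single_apply]
  | add s t hs ht =>
    conv_lhs => rw [hs, ht]
    simp only [map_add, add_tmul, Finset.sum_add_distrib]

theorem coords_map (f : K →ₗ[Rᵐᵒᵖ] L) (n : ℕ) (i : Fin n) (t : RTensor R K (Fin n → R)) :
    coords R L n i (RTensor.map R _ f t) = f (coords R K n i t) := by
  induction t using RTensor.induction with
  | tmul k v => simp
  | add s t hs ht => simp only [map_add, hs, ht]

/-- Finitely generated free modules are flat. -/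
theorem map_injective_pi (f : K →ₗ[Rᵐᵒᵖ] L) (hf : Function.Injective f) (n : ℕ) :
    Function.Injective (RTensor.map R (Fin n → R) f) := by
  rw [injective_iff_map_eq_zero]
  intro t ht
  rw [eq_sum_coords n t]
  refine Finset.sum_eq_zero fun i _ => ?_
  have : coords R K n i t = 0 := by
    apply hf
    rw [← coords_map, ht, map_zero, map_zero]
  rw [this]
  exact map_zero (tmulLeft _)

end

/-! ### Descent of tensor relations to finitely generated submodules. -/

section Descent

variable {K L E : Type u} [AddCommGroup K] [Module Rᵐᵒᵖ K] [AddCommGroup L] [Module Rᵐᵒᵖ L]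
  [AddCommGroup E] [Module R E]

/-- The map `K ⊗ g` over the integers. -/
def intMapRight (K : Type u) [AddCommGroup K] {M N : Type u} [AddCommGroup M] [Module R M]
    [AddCommGroup N] [Module R N] (g : M →ₗ[R] N) : K ⊗[ℤ] M →+ K ⊗[ℤ] N :=
  (LinearMap.lTensor K g.toAddMonoidHom.toIntLinearMap).toAddMonoidHom

theorem intMapRight_inclusion (K : Type u) [AddCommGroup K] {N N' : Submodule R E} (h : N ≤ N')
    (u : K ⊗[ℤ] N) :
    intMapRight K N'.subtype (intMapRight K (Submodule.inclusion h) u) =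
      intMapRight K N.subtype u :=
  (LinearMap.lTensor_comp_apply _ _ _ _).symm

theorem exists_fg_intMapRight_eq {K : Type u} [AddCommGroup K] (u : K ⊗[ℤ] E) :
    ∃ (N : Submodule R E) (_ : N.FG) (v : K ⊗[ℤ] N), intMapRight K N.subtype v = u := by
  induction u with
  | zero => exact ⟨⊥, Submodule.fg_bot, 0, map_zero _⟩
  | tmul k e =>
    exact ⟨Submodule.span R {e}, Submodule.fg_span_singleton e,
      k ⊗ₜ ⟨e, Submodule.mem_span_singleton_self e⟩, rfl⟩
  | add x y hx hy =>
    obtain ⟨N, hN, v, rfl⟩ := hx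
    obtain ⟨N', hN', v', rfl⟩ := hy
    refine ⟨N ⊔ N', hN.sup hN', intMapRight K (Submodule.inclusion le_sup_left) v +
      intMapRight K (Submodule.inclusion le_sup_right) v', ?_⟩
    rw [map_add, intMapRight_inclusion, intMapRight_inclusion]

theorem exists_fg_balancingSubgroup (u : K ⊗[ℤ] E) (hu : u ∈ balancingSubgroup R K E) :
    ∃ (N : Submodule R E) (_ : N.FG) (v : K ⊗[ℤ] N), v ∈ balancingSubgroup R K N ∧
      intMapRight K N.subtype v = u := by
  induction hu using AddSubgroup.closure_induction with
  | zero => exact ⟨⊥, Submodule.fg_bot, 0, zero_mem _, map_zero _⟩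
  | mem x hx =>
    obtain ⟨k, r, e, rfl⟩ := hx
    refine ⟨Submodule.span R {e}, Submodule.fg_span_singleton e, _,
      AddSubgroup.subset_closure ⟨k, r, ⟨e, Submodule.mem_span_singleton_self e⟩, rfl⟩, ?_⟩
    rw [map_sub]
    rfl
  | add x y _ _ hx hy =>
    obtain ⟨N, hN, v, hv, rfl⟩ := hx
    obtain ⟨N', hN', v', hv', rfl⟩ := hy
    refine ⟨N ⊔ N', hN.sup hN', intMapRight K (Submodule.inclusion le_sup_left) v +
      intMapRight K (Submodule.inclusion le_sup_right) v',
      add_mem (balancingSubgroup_le_comap_lTensor K _ hv)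
        (balancingSubgroup_le_comap_lTensor K _ hv'), ?_⟩
    rw [map_add, intMapRight_inclusion, intMapRight_inclusion]
  | neg x _ hx =>
    obtain ⟨N, hN, v, hv, rfl⟩ := hx
    exact ⟨N, hN, -v, neg_mem hv, map_neg _ _⟩

theorem intMapRight_comm {K : Type u} [AddCommGroup K] {M N : Type u} [AddCommGroup M]
    [Module R M] [AddCommGroup N] [Module R N] (g : M →ₗ[R] N) (w : M ⊗[ℤ] K) :
    intMapRight K g (TensorProduct.comm ℤ M K w) =
      TensorProduct.comm ℤ N K (LinearMap.rTensor K g.toAddMonoidHom.toIntLinearMap w) := by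
  induction w with
  | zero => simp
  | tmul => rfl
  | add x y hx hy => simp only [map_add, hx, hy]

theorem exists_fg_intMapRight_eq_zero {K : Type u} [AddCommGroup K] (N : Submodule R E)
    (hN : N.FG) (u : K ⊗[ℤ] N)   (hu : intMapRight K N.subtype u = 0) :
    ∃ (N' : Submodule R E) (h : N ≤ N'), N'.FG ∧
      intMapRight K (Submodule.inclusion h) u = 0 := by
  obtain ⟨w, rfl⟩ := (TensorProduct.comm ℤ N K).surjective u
  rw [intMapRight_comm, LinearEquiv.map_eq_zero_iff] at hu
  obtain ⟨P, hP, y, rfl⟩ := Submodule.exists_fg_le_eq_rTensor_subtype w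
  let j : N →ₗ[ℤ] E := N.subtype.toAddMonoidHom.toIntLinearMap
  have hy : LinearMap.rTensor K (P.map j).subtype
      (LinearMap.rTensor K (j.submoduleMap P) y) = 0 := by
    rw [← hu, ← LinearMap.rTensor_comp_apply, ← LinearMap.rTensor_comp_apply]
    rfl
  -- Over ℤ the vanishing is witnessed in a finitely generated subgroup `Q`; adding the `R`-span of
  -- its generators to `N` gives the submodule sought.
  obtain ⟨Q, hPQ, hQ, h0⟩ := TensorProduct.eq_zero_of_fg_of_subtype_eq_zero (hP.map j) hy
  obtain ⟨s, hs⟩ := hQ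
  have hle : ∀ x : Q, x.1 ∈ N ⊔ Submodule.span R s := by
    intro x
    have hQs : Q ≤ (Submodule.span R (s : Set E)).toAddSubgroup.toIntSubmodule := by
      rw [← hs, Submodule.span_le]
      exact Submodule.subset_span
    exact le_sup_right (a := N) (hQs x.2)
  let q : Q →ₗ[ℤ] (N ⊔ Submodule.span R (s : Set E) : Submodule R E) :=
    (AddMonoidHom.mk' (fun x => ⟨x.1, hle x⟩) fun x y => rfl).toIntLinearMap
  refine ⟨N ⊔ Submodule.span R s, le_sup_left, hN.sup (Submodule.fg_span s.finite_toSet), ?_⟩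
  have := congrArg (LinearMap.rTensor K q) h0
  rw [map_zero, ← LinearMap.rTensor_comp_apply, ← LinearMap.rTensor_comp_apply] at this
  rw [intMapRight_comm, ← LinearMap.rTensor_comp_apply, LinearEquiv.map_eq_zero_iff]
  exact this

/-- The vanishing of the image of a tensor under `f ⊗ E` is witnessed in a finitely generated
submodule of `E`. -/
theorem exists_fg_map_eq_zero (f : K →ₗ[Rᵐᵒᵖ] L) (t : RTensor R K E)
    (ht : RTensor.map R E f t = 0) : ∃ (N : Submodule R E) (_ : N.FG) (s : RTensor R K N),
      mapRight K N.subtype s = t ∧ RTensor.map R N f s = 0 := by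
  obtain ⟨u, rfl⟩ := QuotientAddGroup.mk_surjective t
  obtain ⟨N₀, hN₀, v, rfl⟩ := exists_fg_intMapRight_eq (R := R) u
  let fZ : K →ₗ[ℤ] L := f.toAddMonoidHom.toIntLinearMap
  have hmem : LinearMap.rTensor E fZ (intMapRight K N₀.subtype v) ∈ balancingSubgroup R L E :=
    (QuotientAddGroup.eq_zero_iff _).1 ht
  obtain ⟨N₁, hN₁, w, hw, hwv⟩ := exists_fg_balancingSubgroup _ hmem
  have hnat : ∀ {M N : Type u} [AddCommGroup M] [Module R M] [AddCommGroup N] [Module R N]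
      (g : M →ₗ[R] N) (x : K ⊗[ℤ] M), LinearMap.rTensor N fZ (intMapRight K g x) =
        intMapRight L g (LinearMap.rTensor M fZ x) := by
    intro M N _ _ _ _ g x
    induction x with
    | zero => simp
    | tmul => rfl
    | add x y hx hy => simp only [map_add, hx, hy]
  let i₀ := Submodule.inclusion (le_sup_left : N₀ ≤ N₀ ⊔ N₁)
  let i₁ := Submodule.inclusion (le_sup_right : N₁ ≤ N₀ ⊔ N₁)
  -- The image of `v` and the balancing element `w` agree only in `L ⊗ E`; a further enlargement
  -- makes them agree over a finitely generated submodule.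
  obtain ⟨N, hN, hfg, h0⟩ := exists_fg_intMapRight_eq_zero (K := L) (N₀ ⊔ N₁) (hN₀.sup hN₁)
    (LinearMap.rTensor _ fZ (intMapRight K i₀ v) - intMapRight L i₁ w) (by
      rw [map_sub, ← hnat, intMapRight_inclusion, intMapRight_inclusion, hwv, sub_self])
  let i := Submodule.inclusion hN
  refine ⟨N, hfg, QuotientAddGroup.mk (intMapRight K i (intMapRight K i₀ v)), ?_, ?_⟩
  · refine congrArg QuotientAddGroup.mk ?_
    change intMapRight K N.subtype _ = _
    rw [intMapRight_inclusion, intMapRight_inclusion]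
  · refine (QuotientAddGroup.eq_zero_iff _).2 ?_
    change LinearMap.rTensor N fZ (intMapRight K i (intMapRight K i₀ v)) ∈ _
    rw [map_sub, sub_eq_zero] at h0
    rw [hnat, h0]
    exact balancingSubgroup_le_comap_lTensor L i (balancingSubgroup_le_comap_lTensor L i₁ hw)

end Descent

end RTensor

/-! ### Flatness of the injective hull. -/

open RTensor

/-- A module is flat if the inclusions of its finitely generated submodules factor through
finitely generated free modules. -/
theorem isFlat_of_factors {E : Type u} [AddCommGroup E] [Module R E]
    (h : ∀ N : Submodule R E, N.FG → ∃ (k : ℕ) (a : N →ₗ[R] (Fin k → R))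
      (b : (Fin k → R) →ₗ[R] E), b ∘ₗ a = N.subtype) : IsFlat R E := by
  intro K L _ _ _ _ f hf
  rw [injective_iff_map_eq_zero]
  intro t ht
  obtain ⟨N, hN, s, rfl, hs⟩ := exists_fg_map_eq_zero f t ht
  obtain ⟨k, a, b, hab⟩ := h N hN
  have : mapRight K a s = 0 := by
    apply map_injective_pi f hf k
    rw [map_mapRight, hs, map_zero, map_zero]
  rw [← hab, mapRight_comp, this, map_zero]

/-- A finitely generated submodule of the hull embeds in some `R ^ k`, and its inclusion extends
over `R ^ k` by injectivity. -/
theorem SeparatesFG.isFlat_injectiveHull [IsNoetherian R R] (hr : IsRightCoherent R)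
    (h : SeparatesFG R) : IsFlat R (injectiveHull R R) := by
  have hE := isInjectiveHull_toInjectiveHull R R
  refine isFlat_of_factors fun N hN => ?_
  have : Module.Finite R N := Module.Finite.iff_fg.2 hN
  obtain ⟨k, a, ha⟩ := h.exists_injective_pi hr N
  obtain ⟨b, hb⟩ := hE.injective_module.out a ha N.subtype
  exact ⟨k, a, b, LinearMap.ext hb⟩

theorem separatesFG_of_isFlat [IsNoetherian R R] {E : Type u} [AddCommGroup E] [Module R E]
    (hc : IsCogenerator R E) (hflat : IsFlat R E) : SeparatesFG R := by
  intro N _ _ hN x hx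
  by_contra! h0
  obtain ⟨g, hg⟩ := hc R N (LinearMap.toSpanSingleton R N x)
    (fun h => hx (by simpa using LinearMap.congr_fun h 1))
  refine hg (LinearMap.ext_ring ?_)
  obtain ⟨n, m, A, p, hp, hA⟩ := exists_matrix_presentation (R := R) N
  obtain ⟨c, rfl⟩ := hp x
  obtain ⟨φ, hφ⟩ := exists_hom_columns hp hA c h0
  let T := Fintype.linearCombination Rᵐᵒᵖ (columns A)
  let e : Fin m → E := fun j => g (p (Pi.single j 1))
  -- In `R ^ n ⊗ E` this element regroups into the values of `g` on the relations `p (A i) = 0`, so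
  -- it dies there; flatness then gives `t = 0`.
  let t : RTensor R (LinearMap.range T) E := ∑ j, tmul R (T.rangeRestrict (Pi.single j 1)) (e j)
  have ht : t = 0 := by
    apply hflat _ _ (LinearMap.range T).subtype (LinearMap.range T).injective_subtype
    have hT : ∀ j, (LinearMap.range T).subtype (T.rangeRestrict (Pi.single j 1)) =
        ∑ i, op (A i j) • (Pi.single i 1 : Fin n → Rᵐᵒᵖ) := by
      intro j
      rw [← columns_eq_sum]
      exact (Fintype.linearCombination_apply_single Rᵐᵒᵖ (columns A) j 1).trans (one_smul _ _)
    simp only [t, map_sum, map_zero, map_tmul, hT, sum_tmul, smul_tmul]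
    rw [Finset.sum_comm]
    refine Finset.sum_eq_zero fun i _ => ?_
    rw [← tmul_sum, ← hom_apply_eq_sum]
    have hAi : p (A i) = 0 := by
      rw [← LinearMap.mem_ker, hA]
      exact Submodule.subset_span ⟨i, rfl⟩
    rw [hAi, map_zero]
    exact map_zero (tmulRight _)
  -- This induces `φ ⊗ E` followed by the action `R ⊗ E → E`; it sends `t` to `∑ j, c j • e j`,
  -- which is `g (p c)`.
  let B : LinearMap.range T →+ E →+ E := AddMonoidHom.mk'
    (fun k => AddMonoidHom.mk' (fun y => φ k • y) (smul_add _)) fun k k' => by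
      ext y
      simp [add_smul]
  have hB : ∀ k (r : R) y, B (op r • k) y = B k (r • y) := by
    intro k r y
    change φ (op r • k) • y = φ k • r • y
    rw [map_smul, op_smul_eq_mul, mul_smul]
  have h1 := congrArg (lift B hB) ht
  rw [map_zero, map_sum] at h1
  have h2 : ∑ j, c j • e j = 0 := by
    rw [← h1]
    refine Finset.sum_congr rfl fun j _ => ?_
    change _ = φ (T.rangeRestrict (Pi.single j 1)) • e j
    rw [hφ, Fintype.linearCombination_apply_single, one_smul]
  rw [← hom_apply_eq_sum] at h2
  simpa using h2

end FGF

theorem mainTheorem8 (R : Type u) [Ring R]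
    (hl : FGF.IsLeftCoherent R) (hr : FGF.IsRightCoherent R) :
    List.TFAE
      [FGF.IsLeftFGF R,
       IsNoetherian R R ∧ FGF.IsFPCogenerator R R,
       IsNoetherian R R ∧ FGF.IsFPInjective Rᵐᵒᵖ R,
       IsNoetherian R R ∧ FGF.IsLeftKasch R ∧ FGF.IsFlat R (FGF.injectiveHull R R)] := by
  tfae_have 1 → 2 := fun h => by
    have := h.isNoetherian hl
    exact ⟨this, FGF.isFPCogenerator_iff_separatesFG.2 h.separatesFG⟩
  tfae_have 2 → 1 := fun ⟨_, h⟩ => (FGF.isFPCogenerator_iff_separatesFG.1 h).isLeftFGF hr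
  tfae_have 1 → 3 := fun h => ⟨h.isNoetherian hl, h.separatesFG.isFPInjective⟩
  tfae_have 3 → 1 := fun ⟨_, h⟩ => h.separatesFG.isLeftFGF hr
  tfae_have 1 → 4 := fun h => by
    have := h.isNoetherian hl
    exact ⟨this, h.separatesFG.isLeftKasch, h.separatesFG.isFlat_injectiveHull hr⟩
  tfae_have 4 → 1 := fun ⟨_, h, hflat⟩ => (FGF.separatesFG_of_isFlat h.2 hflat).isLeftFGF hr
  tfae_finish
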